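/- **Theorem.** For each $n=1,2,\ldots$ let $X^{(1)},\ldots,X^{(n)}$ be i.i.d. $\mathcal N_p(0,\Sigma_0)$, where $p=p_n\ge 1$ and $\Sigma_0=\Sigma_{0,n}$ may change with $n$ and $\Sigma_{0,ii}=1$ for all $i$. Let $\Theta_0=\Sigma_0^{-1}=(\theta_{0,ij})$, let $E_0$ be the undirected graph on $\{1,\ldots,p\}$ with an edge between $i\neq j$ if and only if $\theta_{0,ij}\neq 0$, and let $S=|E_0|=\sum_{i=1}^p s^i$, where $s^i$ is the degree of node $i$ in $E_0$ (so sizes of edge sets count ordered pairs). Assume: (A1) $p\to\infty$ as $n\to\infty$, $p=o(e^{cn})$ for some constant $0<c<1$, and $S=o\big(n/\log\max(n,p)\big)$. (A2) There are constants $0<M_{\mathrm{low}}\le M_{\mathrm{upp}}<\infty$, not depending on $n$, such that all eigenvalues of $\Sigma_0$ lie in $[M_{\mathrm{low}},M_{\mathrm{upp}}]$, and there is a constant $v^2>0$ with $1/\theta_{0,ii}\ge v^2$ for all $i$. For each $n$ let $E$ be a (possibly random and data-dependent) set of undirected edges on $\{1,\ldots,p\}$, and suppose that there are events $\mathcal E=\mathcal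 E_n$ with $\mathbb P(\mathcal E)\ge 1-d/p^2$ for a constant $d$, such that on $\mathcal E$ we have $E_0\subseteq E$ and $|E\setminus E_0|=O(S)$ (with a deterministic constant, for all large $n$). Let $\hat S_n=n^{-1}\sum_{r=1}^n X^{(r)}(X^{(r)})^T$, let $\hat\Gamma_n=\mathrm{diag}(\hat S_n)^{-1/2}\,\hat S_n\,\mathrm{diag}(\hat S_n)^{-1/2}$ be the sample correlation matrix, and let $$\hat\Theta_n(E)=\operatorname*{argmin}\big\{\mathrm{tr}(\Theta\hat\Gamma_n)-\log|\Theta| \;:\; \Theta\in\mathbb R^{p\times p},\ \Theta\succ0,\ \theta_{ij}=0\ \text{for all } i\ne j \text{ with } (i,j)\notin E\big\}$$ (and $\hat\Theta_n(E)=0$ if there is no minimizer). Then, with probability tending to one as $n\to\infty$, the minimizer exists and is unique, and $$\|\hat\Theta_n(E)-\Theta_0\|_F=O_P\Big(\sqrt{S\log\max(n,p)/n}\Big),$$ that is, for every $\varepsilon>0$ there is a constant $K$ such that for all large $n$ the inequality $\|\hat\Theta_n(E)-\Theta_0\|_F>K\sqrt{S\log\max(n,p)/n}$ has probability at most $\varepsilon$.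 -/

import Mathlib

open MeasureTheory ProbabilityTheory Filter Topology Asymptotics
open scoped Matrix.Norms.Frobenius

/-- The size of a set of undirected edges, counted as the sum of the node degrees
(that is, every undirected edge counts as the two ordered pairs `(i, j)` and `(j, i)`). -/
noncomputable def edgeSize {p : ℕ} (G : SimpleGraph (Fin p)) : ℕ :=
  ∑ i, (G.neighborSet i).ncard

/-- The conditional independence graph of a Gaussian vector with symmetric precision matrix `Θ`:
`i` and `j ≠ i` are joined if and only if `Θ i j ≠ 0`. (Symmetry is built in by asking for one of
the two entries to be non-zero, which is the same thing when `Θ` is symmetric.) -/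
def concentrationGraph {p : ℕ} (Θ : Matrix (Fin p) (Fin p) ℝ) : SimpleGraph (Fin p) where
  Adj i j := i ≠ j ∧ (Θ i j ≠ 0 ∨ Θ j i ≠ 0)
  symm := ⟨fun _ _ h => ⟨h.1.symm, h.2.symm⟩⟩
  loopless := ⟨fun _ h => h.1 rfl⟩

/-- The sample covariance matrix `n⁻¹ ∑ᵣ x⁽ʳ⁾ (x⁽ʳ⁾)ᵀ` (the mean is known to be zero). -/
noncomputable def sampleCovariance {n p : ℕ} (x : Fin n → EuclideanSpace ℝ (Fin p)) :
    Matrix (Fin p) (Fin p) ℝ :=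
  (n : ℝ)⁻¹ • ∑ r, Matrix.vecMulVec (x r) (x r)

/-- The sample correlation matrix `diag(Ŝ)^{-1/2} Ŝ diag(Ŝ)^{-1/2}`. -/
noncomputable def sampleCorrelation {n p : ℕ} (x : Fin n → EuclideanSpace ℝ (Fin p)) :
    Matrix (Fin p) (Fin p) ℝ :=
  Matrix.diagonal (fun i => (Real.sqrt (sampleCovariance x i i))⁻¹) * sampleCovariance x *
    Matrix.diagonal (fun i => (Real.sqrt (sampleCovariance x i i))⁻¹)

/-- The symmetric positive definite matrices whose off-diagonal entries vanish off the edges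
of `E`. -/
def constrainedPosDef {p : ℕ} (E : SimpleGraph (Fin p)) : Set (Matrix (Fin p) (Fin p) ℝ) :=
  {Θ | Θ.PosDef ∧ ∀ i j, i ≠ j → ¬ E.Adj i j → Θ i j = 0}

/-- The (negative log-likelihood) objective `tr(Θ Γ) - log |Θ|`. -/
noncomputable def likelihoodLoss {p : ℕ} (Γ Θ : Matrix (Fin p) (Fin p) ℝ) : ℝ :=
  (Θ * Γ).trace - Real.log Θ.det

/-- `Θ` is a minimizer of `tr(Θ Γ̂) - log |Θ|` over the constrained set of `E`, where `Γ̂` is the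
sample correlation matrix of the sample `x`. -/
def IsRefittedMLE {n p : ℕ} (x : Fin n → EuclideanSpace ℝ (Fin p)) (E : SimpleGraph (Fin p))
    (Θ : Matrix (Fin p) (Fin p) ℝ) : Prop :=
  Θ ∈ constrainedPosDef E ∧
    ∀ Θ' ∈ constrainedPosDef E,
      likelihoodLoss (sampleCorrelation x) Θ ≤ likelihoodLoss (sampleCorrelation x) Θ'

open Classical in
/-- The refitted maximum likelihood estimator: the minimizer when there is one (it is then
unique, the loss being strictly convex), and the zero matrix otherwise. -/
noncomputable def refittedMLE {n p : ℕ} (x : Fin n → EuclideanSpace ℝ (Fin p))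
    (E : SimpleGraph (Fin p)) : Matrix (Fin p) (Fin p) ℝ :=
  if h : ∃ Θ, IsRefittedMLE x E Θ then h.choose else 0

/-- `Z n = O_P(r n)` as `n → ∞`. -/
def IsBigOP {Ω : ℕ → Type*} [∀ n, MeasurableSpace (Ω n)] (P : ∀ n, Measure (Ω n))
    (Z : ∀ n, Ω n → ℝ) (r : ℕ → ℝ) : Prop :=
  ∀ ε : ℝ, 0 < ε → ∃ K : ℝ, 0 < K ∧
    ∀ᶠ n in atTop, P n {ω | K * r n < |Z n ω|} ≤ ENNReal.ofReal ε

/-- The dimension grows with `p = o(exp (c n))` for some `0 < c < 1`, and the sparsity satisfies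
`S = o(n / log max(n, p))`. -/
structure GrowthAssumption (p S : ℕ → ℕ) : Prop where
  dim_tendsto : Tendsto p atTop atTop
  dim_isLittleO : ∃ c : ℝ, 0 < c ∧ c < 1 ∧
    (fun n => (p n : ℝ)) =o[atTop] (fun n => Real.exp (c * n))
  sparsity_isLittleO :
    (fun n => (S n : ℝ)) =o[atTop] (fun n => (n : ℝ) / Real.log ((max n (p n) : ℕ) : ℝ))

/-- The eigenvalues of the covariance matrices lie in a fixed interval `[Mlow, Mupp]` with
`0 < Mlow ≤ Mupp < ∞`, and the residual variances `1 / θ_{ii}` of the nodewise regressions are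
at least some fixed `v² > 0`. -/
structure SpectralAssumption {p : ℕ → ℕ} (S₀ : ∀ n, Matrix (Fin (p n)) (Fin (p n)) ℝ) : Prop where
  eigenvalues : ∃ Mlow Mupp : ℝ, 0 < Mlow ∧ Mlow ≤ Mupp ∧
    ∀ n, ∀ x ∈ spectrum ℝ (S₀ n), Mlow ≤ x ∧ x ≤ Mupp
  residualVariance : ∃ v : ℝ, 0 < v ^ 2 ∧ ∀ n i, v ^ 2 ≤ 1 / (S₀ n)⁻¹ i i

/-! A basic inequality with a deterministic convexity core and a Gaussian concentration input. Write
`Θ₀ = Σ₀⁻¹` and `D = Θ - Θ₀`. The excess loss of `Θ` over `Θ₀` splits exactly (`likelihoodLoss_sub`)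
into the Bregman gap of `-log det` at `Θ₀` and a linear term `tr(D (Γ̂ - Σ₀))`. The gap grows at
least quadratically in `‖D‖` near zero and linearly far away (`Matrix.PosDef.log_det_gap`). In the
linear term the diagonal drops out, because both matrices have unit diagonal, so Cauchy–Schwarz over
the edges alone bounds it by `max |Γ̂ - Σ₀| · √|E| · ‖D‖`, with `|E| = O(S)` on the screening event.

Hence every feasible `Θ` with loss at most that of `Θ₀` lies in a Frobenius ball of radius `O(√(S
log max(n,p) / n))`. Eventually this ball lies inside the positive definite cone, so compactness
gives a minimizer, strict convexity makes it unique, and the radius is the claimed rate.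

The probabilistic input is that all entries of the sample covariance are within `O(√(log max(n,p) /
n))` of `Σ₀`: polarisation, a chi-square Chernoff bound and a union bound. If `S = 0` this is not
needed: the linear term vanishes once the sample variances are positive. -/

namespace Matrix

/-! ### Frobenius norm, traces and square roots. -/

variable {m : Type*} [Fintype m] [DecidableEq m]

theorem IsHermitian.trace_mul_self_eq_sum {N : Matrix m m ℝ} (hN : N.IsHermitian) :
    (N * N).trace = ∑ i, hN.eigenvalues i ^ 2 := by
  conv_lhs => rw [hN.spectral_theorem, ← map_mul, diagonal_mul_diagonal,
    Unitary.conjStarAlgAut_apply, trace_mul_cycle, Unitary.coe_star_mul_self, one_mul,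
    trace_diagonal]
  simp [sq]

theorem frobenius_norm_sq_eq_trace {k l : Type*} [Fintype k] [Fintype l]
    (A : Matrix l k ℝ) :
    ‖A‖ ^ 2 = (A * Aᵀ).trace := by
  rw [frobenius_norm_def, ← Real.sqrt_eq_rpow, Real.sq_sqrt (by positivity)]
  simp [trace, mul_apply, sq]

theorem frobenius_norm_sq_eq_sum {k l : Type*} [Fintype k] [Fintype l]
    (A : Matrix l k ℝ) :
    ‖A‖ ^ 2 = ∑ i, ∑ j, A i j ^ 2 := by
  rw [frobenius_norm_def, ← Real.sqrt_eq_rpow, Real.sq_sqrt (by positivity)]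
  simp

theorem PosDef.exists_symm_sqrt {A : Matrix m m ℝ} (hA : A.PosDef) :
    ∃ R : Matrix m m ℝ, R.IsHermitian ∧ R * R = A ∧ R * A⁻¹ * R = 1 := by
  open scoped MatrixOrder in
  have h1 : CFC.sqrt A * CFC.sqrt A = A := CFC.sqrt_mul_sqrt_self A hA.posSemidef.nonneg
  open scoped MatrixOrder in
  refine ⟨CFC.sqrt A, (CFC.sqrt_nonneg A).isSelfAdjoint, h1, ?_⟩
  rw [mul_eq_one_comm, ← mul_assoc, h1]
  exact mul_nonsing_inv _ ((isUnit_iff_isUnit_det A).mp hA.isUnit)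

theorem trace_mul_mul_transpose_ge {A : Matrix m m ℝ} {a : ℝ} (hA : (A - a • 1).PosSemidef)
    {l : Type*} [Fintype l] (C : Matrix l m ℝ) :
    a * (C * Cᵀ).trace ≤ (C * A * Cᵀ).trace := by
  have h := (hA.mul_mul_conjTranspose_same C).trace_nonneg
  simp only [conjTranspose_eq_transpose_of_trivial, Matrix.mul_sub,
    Matrix.sub_mul, trace_sub, Matrix.mul_smul, Matrix.smul_mul, Matrix.mul_one, trace_smul,
    smul_eq_mul] at h
  linarith

end Matrix

/-! ### Quantitative convexity of `-log det`. -/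

/-- From `log x = 2 log √x ≤ 2(√x - 1)` the right side is at least `(√x - 1)² = (x - 1)² / (√x +
1)²`, and `(√x + 1)² ≤ 2(x + 1) ≤ 2(2 + ρ)`. -/
theorem Real.sq_div_le_sub_one_sub_log {x ρ : ℝ} (hx : 0 < x) (hρ : |x - 1| ≤ ρ) :
    (x - 1) ^ 2 / (2 * (2 + ρ)) ≤ x - 1 - Real.log x := by
  have hs : 0 < √x := Real.sqrt_pos.mpr hx
  have hsq : √x ^ 2 = x := Real.sq_sqrt hx.le
  have hlog : Real.log x ≤ 2 * (√x - 1) := by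
    have := Real.log_le_sub_one_of_pos hs
    rw [Real.log_sqrt hx.le] at this
    linarith
  have hρ' := (abs_le.mp hρ)
  have h0 : 0 ≤ ρ := (abs_nonneg _).trans hρ
  have h1 : (x - 1) ^ 2 / (2 * (2 + ρ)) ≤ (√x - 1) ^ 2 := by
    rw [div_le_iff₀ (by linarith)]
    have : (x - 1) ^ 2 = (√x - 1) ^ 2 * (√x + 1) ^ 2 := by
      nth_rewrite 1 [← hsq]; ring
    rw [this]
    gcongr
    nlinarith [sq_nonneg (√x - 1)]
  nlinarith

theorem sq_div_mono {s t : ℝ} (hs : 0 ≤ s) (hst : s ≤ t) :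
    s ^ 2 / (2 * (2 + s)) ≤ t ^ 2 / (2 * (2 + t)) := by
  rw [div_le_div_iff₀ (by linarith) (by linarith)]
  nlinarith [mul_nonneg hs (hs.trans hst), mul_nonneg (mul_nonneg hs (hs.trans hst)) (sub_nonneg.mpr hst),
    mul_nonneg (sub_nonneg.mpr hst) (add_nonneg hs (hs.trans hst))]

namespace Matrix

variable {m : Type*} [Fintype m] [DecidableEq m]

/-- Sum the scalar inequality over the eigenvalues; each is within `‖N - 1‖` of one, so a single `ρ`
serves for all. -/
theorem PosDef.norm_sub_one_le_log_det {N : Matrix m m ℝ} (hN : N.PosDef) :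
    ‖N - 1‖ ^ 2 / (2 * (2 + ‖N - 1‖)) ≤ (N - 1).trace - Real.log N.det := by
  set ν := hN.1.eigenvalues
  have htr : N.trace = ∑ i, ν i := by simpa using hN.1.trace_eq_sum_eigenvalues
  have hnorm : ‖N - 1‖ ^ 2 = ∑ i, (ν i - 1) ^ 2 := by
    have hT : (N - 1)ᵀ = N - 1 := by
      have := hN.1.eq
      rw [conjTranspose_eq_transpose_of_trivial] at this
      simp [this]
    rw [frobenius_norm_sq_eq_trace, hT]
    have : (N - 1) * (N - 1) = N * N - (N + N) + 1 := by noncomm_ring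
    rw [this, trace_add, trace_sub, trace_add, hN.1.trace_mul_self_eq_sum, htr, trace_one]
    simp only [sub_sq, Finset.sum_add_distrib, Finset.sum_sub_distrib, one_pow, mul_one,
      ← Finset.mul_sum, Finset.sum_const, Finset.card_univ, nsmul_eq_mul]
    ring
  have hdet : Real.log N.det = ∑ i, Real.log (ν i) := by
    rw [hN.1.det_eq_prod_eigenvalues]
    simp only [RCLike.ofReal_real_eq_id, id]
    exact Real.log_prod fun i _ => (hN.eigenvalues_pos i).ne'
  rw [hdet, trace_sub, htr, trace_one, hnorm, Finset.sum_div]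
  have : (Fintype.card m : ℝ) = ∑ _i : m, (1 : ℝ) := by simp
  rw [this, ← Finset.sum_sub_distrib, ← Finset.sum_sub_distrib]
  refine Finset.sum_le_sum fun i _ => Real.sq_div_le_sub_one_sub_log (hN.eigenvalues_pos i) ?_
  refine abs_le_of_sq_le_sq ?_ (norm_nonneg _)
  rw [hnorm]
  exact Finset.single_le_sum (f := fun i => (ν i - 1) ^ 2) (fun _ _ => sq_nonneg _)
    (Finset.mem_univ i)

/-- Conjugation by `R = A^{-1/2}` moves the base point to the identity: it preserves the gap, and
shrinks `‖B - A‖` by at most the factor `a`. -/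
theorem PosDef.log_det_gap {A B : Matrix m m ℝ} (hA : A.PosDef) (hB : B.PosDef) {a : ℝ}
    (ha : 0 ≤ a) (hAa : (A⁻¹ - a • 1).PosSemidef) :
    (a * ‖B - A‖) ^ 2 / (2 * (2 + a * ‖B - A‖)) ≤
      Real.log A.det + ((B - A) * A⁻¹).trace - Real.log B.det := by
  obtain ⟨R, hR, hRR, hRA⟩ := hA.inv.exists_symm_sqrt
  have hRT : Rᵀ = R := by rw [← conjTranspose_eq_transpose_of_trivial]; exact hR
  have hAu : IsUnit A.det := (isUnit_iff_isUnit_det A).mp hA.isUnit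
  rw [nonsing_inv_nonsing_inv _ hAu] at hRA
  have hRu : IsUnit R := IsUnit.of_mul_eq_one (A * R) (by rw [← mul_assoc, hRA])
  have hN : (R * B * R).PosDef := by
    have := hB.conjTranspose_mul_mul_same (mulVec_injective_iff_isUnit.mpr hRu)
    rwa [hR.eq] at this
  have hsub : R * B * R - 1 = R * (B - A) * R := by rw [← hRA]; noncomm_ring
  have hΔT : (B - A)ᵀ = B - A := by
    have h1 := hA.1.eq
    have h2 := hB.1.eq
    rw [conjTranspose_eq_transpose_of_trivial] at h1 h2
    simp [h1, h2]
  have key := hN.norm_sub_one_le_log_det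
  have htr : (R * (B - A) * R).trace = ((B - A) * A⁻¹).trace := by
    rw [trace_mul_cycle, hRR, trace_mul_comm]
  have hdet : Real.log (R * B * R).det = Real.log B.det - Real.log A.det := by
    have h1 : (R * B * R).det = A.det⁻¹ * B.det := by
      have h2 : R.det * R.det = A.det⁻¹ := by
        rw [← det_mul, hRR, det_nonsing_inv, Ring.inverse_eq_inv']
      rw [det_mul, det_mul, ← h2]; ring
    rw [h1, Real.log_mul (inv_ne_zero hA.det_pos.ne') hB.det_pos.ne', Real.log_inv]
    ring
  rw [hsub, htr, hdet] at key
  have hnorm : a * ‖B - A‖ ≤ ‖R * (B - A) * R‖ := by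
    refine le_of_sq_le_sq ?_ (norm_nonneg _)
    rw [mul_pow, frobenius_norm_sq_eq_trace, frobenius_norm_sq_eq_trace]
    simp only [transpose_mul, hΔT, hRT]
    set D := B - A
    have e1 : (R * D * R * (R * (D * R))).trace = ((R * D) * A⁻¹ * (R * D)ᵀ).trace := by
      rw [transpose_mul, hRT, hΔT, ← hRR]; simp only [mul_assoc]
    have e2 : ((R * D) * (R * D)ᵀ).trace = (D * A⁻¹ * Dᵀ).trace := by
      rw [transpose_mul, hRT, hΔT, ← hRR, trace_mul_comm]
      simp only [mul_assoc]
    have i1 := trace_mul_mul_transpose_ge hAa (R * D)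
    have i2 := trace_mul_mul_transpose_ge hAa D
    rw [e1]
    rw [e2] at i1
    rw [hΔT] at i1 i2
    nlinarith [mul_le_mul_of_nonneg_left i2 ha]
  have := sq_div_mono (mul_nonneg ha (norm_nonneg _)) hnorm
  linarith

/-! ### Spectral bounds and the Loewner order. -/

theorem PosSemidef.sub_smul_one_of_spectrum {A : Matrix m m ℝ} (hA : A.IsHermitian) {a : ℝ}
    (h : ∀ x ∈ spectrum ℝ A, a ≤ x) : (A - a • 1).PosSemidef := by
  rw [posSemidef_iff_isHermitian_and_spectrum_nonneg]
  refine ⟨hA.sub (by simp [IsHermitian]), fun x hx => ?_⟩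
  rw [← Algebra.algebraMap_eq_smul_one, ← spectrum.sub_singleton_eq, Set.mem_sub] at hx
  obtain ⟨y, hy, c, rfl, rfl⟩ := hx
  exact sub_nonneg.mpr (h y hy)

theorem PosSemidef.smul_one_sub_of_spectrum {A : Matrix m m ℝ} (hA : A.IsHermitian) {b : ℝ}
    (h : ∀ x ∈ spectrum ℝ A, x ≤ b) : (b • 1 - A).PosSemidef := by
  have := PosSemidef.sub_smul_one_of_spectrum (a := -b) hA.neg (fun x hx => by
    rw [← spectrum.neg_eq, Set.mem_neg] at hx
    linarith [h _ hx])
  convert this using 1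
  simp [neg_smul]; abel

theorem PosDef.inv_sub_smul_one {A : Matrix m m ℝ} (hA : A.PosDef) {b : ℝ} (hb : 0 < b)
    (h : (b • 1 - A).PosSemidef) : (A⁻¹ - b⁻¹ • 1).PosSemidef := by
  obtain ⟨R, hR, hRR, hRA⟩ := hA.inv.exists_symm_sqrt
  rw [nonsing_inv_nonsing_inv _ ((isUnit_iff_isUnit_det A).mp hA.isUnit)] at hRA
  have h1 := (h.smul (inv_nonneg.mpr hb.le)).conjTranspose_mul_mul_same R
  rw [hR.eq] at h1
  convert h1 using 1
  rw [← hRR, smul_sub, smul_smul, inv_mul_cancel₀ hb.ne', one_smul, mul_sub, sub_mul,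
    mul_one, Matrix.mul_smul, Matrix.smul_mul, hRA]

theorem abs_dotProduct_mulVec_le (D : Matrix m m ℝ) (x : m → ℝ) :
    |x ⬝ᵥ D *ᵥ x| ≤ ‖D‖ * (x ⬝ᵥ x) := by
  have hx : 0 ≤ x ⬝ᵥ x := by simpa using dotProduct_star_self_nonneg x
  refine abs_le_of_sq_le_sq ?_ (mul_nonneg (norm_nonneg _) hx)
  have h := Finset.sum_mul_sq_le_sq_mul_sq (Finset.univ : Finset (m × m))
    (fun q => D q.1 q.2) (fun q => x q.1 * x q.2)
  simp only [← Finset.univ_product_univ, Finset.sum_product] at h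
  rw [mul_pow, frobenius_norm_sq_eq_sum]
  convert h using 2
  · simp only [dotProduct, mulVec, Finset.mul_sum]
    exact Finset.sum_congr rfl fun i _ => Finset.sum_congr rfl fun j _ => by ring
  · simp only [dotProduct, sq, Finset.sum_mul_sum]
    exact Finset.sum_congr rfl fun i _ => Finset.sum_congr rfl fun j _ => by ring

theorem posDef_of_norm_sub_lt {A B : Matrix m m ℝ} {a : ℝ} (hA : (A - a • 1).PosSemidef)
    (hB : B.IsHermitian) (h : ‖B - A‖ < a) : B.PosDef := by
  refine PosDef.of_dotProduct_mulVec_pos hB fun {x} hx => ?_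
  simp only [star_trivial]
  have h1 := hA.dotProduct_mulVec_nonneg x
  have h2 := (abs_le.mp (abs_dotProduct_mulVec_le (B - A) x)).1
  simp only [star_trivial, sub_mulVec, dotProduct_sub, smul_mulVec, one_mulVec, dotProduct_smul,
    smul_eq_mul] at h1 h2
  have hx : 0 < x ⬝ᵥ x := by simpa using dotProduct_star_self_pos_iff.mpr hx
  nlinarith [mul_lt_mul_of_pos_right h hx]

end Matrix

theorem Matrix.PosDef.exists_pos_inv_sub_smul_one {m : Type*} [Fintype m] [DecidableEq m]
    {A : Matrix m m ℝ} (hA : A.PosDef) : ∃ a : ℝ, 0 < a ∧ (A⁻¹ - a • 1).PosSemidef := by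
  have hb : 0 < ‖A‖ + 1 := by positivity
  refine ⟨(‖A‖ + 1)⁻¹, inv_pos.mpr hb, hA.inv_sub_smul_one hb ?_⟩
  have hsymm : ((‖A‖ + 1) • (1 : Matrix m m ℝ)).IsHermitian := by simp [Matrix.IsHermitian]
  refine Matrix.PosSemidef.of_dotProduct_mulVec_nonneg (hsymm.sub hA.1) fun x => ?_
  have h := (abs_le.mp (Matrix.abs_dotProduct_mulVec_le A x)).2
  have hx : 0 ≤ x ⬝ᵥ x := Finset.sum_nonneg fun i _ => mul_self_nonneg (x i)
  simp only [star_trivial, Matrix.sub_mulVec, dotProduct_sub, Matrix.smul_mulVec,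
    Matrix.one_mulVec, dotProduct_smul, smul_eq_mul]
  nlinarith

/-! ### Edge counts and the linear term. -/

theorem edgeSize_eq_sum {p : ℕ} (E : SimpleGraph (Fin p)) [DecidableRel E.Adj] :
    (edgeSize E : ℝ) = ∑ i, ∑ j, if E.Adj i j then (1 : ℝ) else 0 := by
  unfold edgeSize
  push_cast
  refine Finset.sum_congr rfl fun i _ => ?_
  rw [Set.ncard_eq_toFinset_card', Finset.sum_boole]
  congr 2
  ext j; simp

theorem edgeSize_le_add_sdiff {p : ℕ} (E F : SimpleGraph (Fin p)) :
    edgeSize E ≤ edgeSize F + edgeSize (E \ F) := by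
  unfold edgeSize
  rw [← Finset.sum_add_distrib]
  refine Finset.sum_le_sum fun i _ => ?_
  refine (Set.ncard_le_ncard ?_ (Set.toFinite _)).trans (Set.ncard_union_le _ _)
  intro j hj
  by_cases h : F.Adj i j
  · exact Or.inl h
  · exact Or.inr ⟨hj, h⟩

/-- Only entries on edges contribute: `W` kills the diagonal and `D` the non-edges. Thus
Cauchy–Schwarz costs `√|E|` with no extra `p`. -/
theorem abs_trace_mul_le_of_support {p : ℕ} (E : SimpleGraph (Fin p))
    {D W : Matrix (Fin p) (Fin p) ℝ} (hD : ∀ i j, i ≠ j → ¬ E.Adj i j → D i j = 0)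
    (hW0 : ∀ i, W i i = 0) {w : ℝ} (hw : 0 ≤ w) (hW : ∀ i j, E.Adj i j → |W j i| ≤ w) :
    |(D * W).trace| ≤ w * √(edgeSize E) * ‖D‖ := by
  classical
  set V : Fin p → Fin p → ℝ := fun i j => if E.Adj i j then W j i else 0
  have htr : (D * W).trace = ∑ q : Fin p × Fin p, D q.1 q.2 * V q.1 q.2 := by
    simp only [Matrix.trace, Matrix.diag, Matrix.mul_apply, ← Finset.univ_product_univ,
      Finset.sum_product, V]
    refine Finset.sum_congr rfl fun i _ => Finset.sum_congr rfl fun j _ => ?_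
    by_cases hij : i = j
    · subst hij; simp [hW0]
    · by_cases hA : E.Adj i j
      · simp [hA]
      · simp [hA, hD i j hij hA]
  have hV : ∑ q : Fin p × Fin p, V q.1 q.2 ^ 2 ≤ w ^ 2 * edgeSize E := by
    rw [← Finset.univ_product_univ, Finset.sum_product, edgeSize_eq_sum, Finset.mul_sum]
    refine Finset.sum_le_sum fun i _ => ?_
    rw [Finset.mul_sum]
    refine Finset.sum_le_sum fun j _ => ?_
    simp only [V]
    split_ifs with h
    · rw [mul_one]; exact sq_le_sq' (abs_le.mp (hW i j h)).1 (abs_le.mp (hW i j h)).2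
    · simp
  have hDn : ∑ q : Fin p × Fin p, D q.1 q.2 ^ 2 = ‖D‖ ^ 2 := by
    rw [← Finset.univ_product_univ, Finset.sum_product, Matrix.frobenius_norm_sq_eq_sum]
  refine abs_le_of_sq_le_sq ?_ (by positivity)
  rw [htr]
  refine (Finset.sum_mul_sq_le_sq_mul_sq _ _ _).trans ?_
  rw [hDn, mul_pow, mul_pow, Real.sq_sqrt (Nat.cast_nonneg _), mul_comm]
  gcongr

/-! ### Localisation, existence and uniqueness of the minimizer. -/

theorem likelihoodLoss_sub {p : ℕ} (Γ A B : Matrix (Fin p) (Fin p) ℝ) :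
    likelihoodLoss Γ B - likelihoodLoss Γ A =
      (Real.log A.det + ((B - A) * A⁻¹).trace - Real.log B.det) +
        ((B - A) * (Γ - A⁻¹)).trace := by
  simp only [likelihoodLoss, mul_sub, sub_mul, Matrix.trace_sub]
  ring

theorem constrainedPosDef_midpoint {p : ℕ} {E : SimpleGraph (Fin p)}
    {A B : Matrix (Fin p) (Fin p) ℝ} (hA : A ∈ constrainedPosDef E) (hB : B ∈ constrainedPosDef E) :
    (2⁻¹ : ℝ) • (A + B) ∈ constrainedPosDef E :=
  ⟨(hA.1.add hB.1).smul (by norm_num), fun i j hij h => by simp [hA.2 i j hij h, hB.2 i j hij h]⟩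

/-- Strict convexity at the midpoint `M`: adding the gaps of `A` and `B` at `M` cancels the linear
parts, so `A ≠ B` would give `M` a smaller loss. -/
theorem IsRefittedMLE.eq {n p : ℕ} {x : Fin n → EuclideanSpace ℝ (Fin p)}
    {E : SimpleGraph (Fin p)} {A B : Matrix (Fin p) (Fin p) ℝ}
    (hA : IsRefittedMLE x E A) (hB : IsRefittedMLE x E B) : A = B := by
  set M : Matrix (Fin p) (Fin p) ℝ := (2⁻¹ : ℝ) • (A + B) with hM
  have hMc : M ∈ constrainedPosDef E := constrainedPosDef_midpoint hA.1 hB.1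
  obtain ⟨a, ha, haM⟩ := hMc.1.exists_pos_inv_sub_smul_one
  have gA := hMc.1.log_det_gap hA.1.1 ha.le haM
  have gB := hMc.1.log_det_gap hB.1.1 ha.le haM
  have hBM : B - M = -(A - M) := by rw [hM]; module
  rw [hBM, norm_neg, Matrix.neg_mul, Matrix.trace_neg] at gB
  have lA := hA.2 M hMc
  have lB := hB.2 M hMc
  have hMM : (M * sampleCorrelation x).trace =
      2⁻¹ * ((A * sampleCorrelation x).trace + (B * sampleCorrelation x).trace) := by
    rw [hM, Matrix.smul_mul, Matrix.add_mul, Matrix.trace_smul, Matrix.trace_add, smul_eq_mul]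
  simp only [likelihoodLoss] at lA lB
  by_contra hAB
  have hne : 0 < ‖A - M‖ := by
    rw [norm_pos_iff, sub_ne_zero]
    intro h
    apply hAB
    have h2 : A = (2 : ℝ) • M - B := by rw [hM]; module
    rw [← h, two_smul] at h2
    have h3 : A - B = (A + A - B) - A := by abel
    rw [← h2, sub_self] at h3
    exact sub_eq_zero.mp h3
  have hpos : 0 < (a * ‖A - M‖) ^ 2 / (2 * (2 + a * ‖A - M‖)) := by positivity
  linarith

theorem norm_sub_le_of_likelihoodLoss_le {p : ℕ} {Γ A B : Matrix (Fin p) (Fin p) ℝ}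
    (hA : A.PosDef) (hB : B.PosDef) {a l : ℝ} (ha : 0 < a) (hAa : (A⁻¹ - a • 1).PosSemidef)
    (hl0 : 0 ≤ l)
    (hl : l ≤ a / 4) (hlin : |((B - A) * (Γ - A⁻¹)).trace| ≤ l * ‖B - A‖)
    (hle : likelihoodLoss Γ B ≤ likelihoodLoss Γ A) : ‖B - A‖ ≤ 8 * l / a ^ 2 := by
  have gap := hA.log_det_gap hB ha.le hAa
  have hsub := likelihoodLoss_sub Γ A B
  have hlow := (abs_le.mp hlin).1
  set u := ‖B - A‖
  have hu : 0 ≤ u := norm_nonneg _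
  have h1 : (a * u) ^ 2 / (2 * (2 + a * u)) ≤ l * u := by linarith
  rw [div_le_iff₀ (by positivity)] at h1
  rw [le_div_iff₀ (by positivity)]
  rcases hu.eq_or_lt with h0 | h0
  · rw [← h0, zero_mul]
    positivity
  -- After division by `u`, the bound reads `a²u ≤ 4l + 2lau`; since `l ≤ a/4` the last term is at
  -- most `a²u/2` and is absorbed on the left.
  · have h2 : a ^ 2 * u ≤ l * (2 * (2 + a * u)) := by
      by_contra! h3
      nlinarith [mul_lt_mul_of_pos_right h3 h0]
    have h3 : l * (a * u) ≤ a / 4 * (a * u) := by gcongr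
    nlinarith

/-- As `r < b`, the closed ball about `A` stays in the open cone, so its feasible part is compact
and the loss is continuous there; any competitor outside the ball has larger loss than `A`. -/
theorem exists_isRefittedMLE {n p : ℕ} (x : Fin n → EuclideanSpace ℝ (Fin p))
    {E : SimpleGraph (Fin p)} {A : Matrix (Fin p) (Fin p) ℝ} (hA : A ∈ constrainedPosDef E)
    {r b : ℝ} (hr : 0 ≤ r) (hrb : r < b) (hAb : (A - b • 1).PosSemidef)
    (hloc : ∀ B ∈ constrainedPosDef E, likelihoodLoss (sampleCorrelation x) B ≤
      likelihoodLoss (sampleCorrelation x) A → ‖B - A‖ ≤ r) :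
    ∃ Θ, IsRefittedMLE x E Θ := by
  set K : Set (Matrix (Fin p) (Fin p) ℝ) :=
    {B | B.IsHermitian ∧ (∀ i j, i ≠ j → ¬ E.Adj i j → B i j = 0)} ∩ Metric.closedBall A r
  have : ProperSpace (Matrix (Fin p) (Fin p) ℝ) := FiniteDimensional.proper_real _
  have hent : ∀ i j, Continuous fun B : Matrix (Fin p) (Fin p) ℝ => B i j := fun i j => by fun_prop
  have hKc : IsCompact K := by
    refine (isCompact_closedBall A r).inter_left (IsClosed.inter ?_ ?_)
    · exact isClosed_eq (by fun_prop) continuous_id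
    · have : IsClosed (⋂ (i) (j) (_ : i ≠ j) (_ : ¬ E.Adj i j),
          {B : Matrix (Fin p) (Fin p) ℝ | B i j = 0}) :=
        isClosed_iInter fun i => isClosed_iInter fun j => isClosed_iInter fun _ =>
          isClosed_iInter fun _ => isClosed_eq (hent i j) continuous_const
      refine isClosed_of_closure_subset fun B hB i j hij h => ?_
      have hB' := this.closure_subset_iff.mpr (fun B hB => ?_) hB
      · simp only [Set.mem_iInter] at hB'
        exact hB' i j hij h
      · simp only [Set.mem_iInter]
        exact hB
  have hKP : ∀ B ∈ K, B ∈ constrainedPosDef E := fun B hB =>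
    ⟨Matrix.posDef_of_norm_sub_lt hAb hB.1.1 ((mem_closedBall_iff_norm.mp hB.2).trans_lt hrb),
      hB.1.2⟩
  have hcont : ContinuousOn (likelihoodLoss (sampleCorrelation x)) K := by
    unfold likelihoodLoss
    refine ContinuousOn.sub (Continuous.continuousOn (by fun_prop)) ?_
    exact ContinuousOn.log (Continuous.continuousOn (by fun_prop))
      fun B hB => (hKP B hB).1.det_pos.ne'
  have hAK : A ∈ K := ⟨⟨hA.1.1, hA.2⟩, Metric.mem_closedBall_self hr⟩
  obtain ⟨Θ, hΘ, hmin⟩ := hKc.exists_isMinOn ⟨A, hAK⟩ hcont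
  refine ⟨Θ, hKP Θ hΘ, fun B hB => ?_⟩
  by_cases h : likelihoodLoss (sampleCorrelation x) B ≤ likelihoodLoss (sampleCorrelation x) A
  · exact hmin ⟨⟨hB.1.1, hB.2⟩, mem_closedBall_iff_norm.mpr (hloc B hB h)⟩
  · exact (hmin hAK).trans (not_le.mp h).le

theorem refittedMLE_spec {n p : ℕ} {x : Fin n → EuclideanSpace ℝ (Fin p)}
    {E : SimpleGraph (Fin p)} (h : ∃ Θ, IsRefittedMLE x E Θ) :
    IsRefittedMLE x E (refittedMLE x E) := by
  rw [refittedMLE, dif_pos h]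
  exact h.choose_spec

theorem inv_mem_constrainedPosDef {p : ℕ} {E : SimpleGraph (Fin p)}
    {T : Matrix (Fin p) (Fin p) ℝ} (hT : T.PosDef) (hE : concentrationGraph T⁻¹ ≤ E) :
    T⁻¹ ∈ constrainedPosDef E := by
  refine ⟨hT.inv, fun i j hij h => ?_⟩
  by_contra h0
  exact h (hE ⟨hij, Or.inl h0⟩)

theorem refittedMLE_of_linear_bound {n p : ℕ} (x : Fin n → EuclideanSpace ℝ (Fin p))
    {E : SimpleGraph (Fin p)} {T : Matrix (Fin p) (Fin p) ℝ} (hT : T.PosDef)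
    (hE : concentrationGraph T⁻¹ ≤ E) {a b l : ℝ} (ha : 0 < a)
    (hTa : (T - a • 1).PosSemidef) (hTb : (T⁻¹ - b • 1).PosSemidef) (hl0 : 0 ≤ l)
    (hl : l ≤ a / 4) (hlb : 8 * l / a ^ 2 < b)
    (hlin : ∀ D : Matrix (Fin p) (Fin p) ℝ, (∀ i j, i ≠ j → ¬ E.Adj i j → D i j = 0) →
      |(D * (sampleCorrelation x - T)).trace| ≤ l * ‖D‖) :
    (∃! Θ, IsRefittedMLE x E Θ) ∧ ‖refittedMLE x E - T⁻¹‖ ≤ 8 * l / a ^ 2 := by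
  have hc := inv_mem_constrainedPosDef hT hE
  have hTT : T⁻¹⁻¹ = T :=
    Matrix.nonsing_inv_nonsing_inv _ ((Matrix.isUnit_iff_isUnit_det T).mp hT.isUnit)
  have hloc : ∀ B ∈ constrainedPosDef E, likelihoodLoss (sampleCorrelation x) B ≤
      likelihoodLoss (sampleCorrelation x) T⁻¹ → ‖B - T⁻¹‖ ≤ 8 * l / a ^ 2 := fun B hB hle => by
    refine norm_sub_le_of_likelihoodLoss_le hc.1 hB.1 ha (by rwa [hTT]) hl0 hl ?_ hle
    rw [hTT]
    exact hlin _ fun i j hij h => by simp [hB.2 i j hij h, hc.2 i j hij h]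
  have hex := exists_isRefittedMLE x hc (by positivity) hlb hTb hloc
  have hspec := refittedMLE_spec hex
  exact ⟨⟨_, hspec, fun _ h => h.eq hspec⟩, hloc _ hspec.1 (hspec.2 _ hc)⟩

/-! ### From sample covariance to sample correlation. -/

/-- Entrywise closeness of the sample covariance passes to the sample correlation. -/
theorem abs_sampleCorrelation_sub_le {n p : ℕ} (x : Fin n → EuclideanSpace ℝ (Fin p))
    {T : Matrix (Fin p) (Fin p) ℝ} (hdiag : ∀ i, T i i = 1) {B t : ℝ} (hB : ∀ i j, |T i j| ≤ B)
    (ht : t ≤ 1 / 2) (hx : ∀ i j, |sampleCovariance x i j - T i j| ≤ t) (i j : Fin p) :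
    |sampleCorrelation x i j - T i j| ≤ 2 * (1 + B) * t := by
  have hi := abs_le.mp (hx i i)
  have hj := abs_le.mp (hx j j)
  rw [hdiag] at hi hj
  set u := sampleCovariance x i i
  set v := sampleCovariance x j j
  set c := sampleCovariance x i j with hc
  have ht0 : 0 ≤ t := (abs_nonneg _).trans (hx i i)
  have hB0 : 0 ≤ B := (abs_nonneg _).trans (hB i i)
  set s := √(u * v)
  have hu : 0 < u := by linarith
  have hv : 0 < v := by linarith
  have hs1 : 1 - t ≤ s := Real.le_sqrt_of_sq_le (by nlinarith)
  have hs2 : s ≤ 1 + t := Real.sqrt_le_iff.mpr ⟨by linarith, by nlinarith⟩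
  have hs0 : 0 < s := by linarith
  have hΓ : sampleCorrelation x i j = c / s := by
    rw [sampleCorrelation, Matrix.mul_diagonal, Matrix.diagonal_mul, ← hc, div_eq_mul_inv,
      show s = √u * √v from Real.sqrt_mul hu.le v, mul_inv]
    ring
  -- The normaliser `s` is within `t` of one, hence at least `1/2`, which costs the factor two.
  have hsub : c / s - T i j = ((c - T i j) + T i j * (1 - s)) / s := by
    field_simp
    ring
  rw [hΓ, hsub, abs_div, abs_of_pos hs0, div_le_iff₀ hs0]
  have h1 : |(c - T i j) + T i j * (1 - s)| ≤ t + B * t := by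
    refine (abs_add_le _ _).trans (add_le_add (hx i j) ?_)
    rw [abs_mul]
    exact mul_le_mul (hB i j) (abs_le.mpr ⟨by linarith, by linarith⟩) (abs_nonneg _) hB0
  refine h1.trans ?_
  nlinarith [mul_nonneg (mul_nonneg (add_nonneg zero_le_one hB0) ht0)
    (show (0 : ℝ) ≤ 2 * s - 1 by linarith)]

theorem sampleCorrelation_self {n p : ℕ} (x : Fin n → EuclideanSpace ℝ (Fin p)) {i : Fin p}
    (hi : 0 < sampleCovariance x i i) : sampleCorrelation x i i = 1 := by
  rw [sampleCorrelation, Matrix.mul_diagonal, Matrix.diagonal_mul]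
  have := Real.mul_self_sqrt hi.le
  have h := Real.sqrt_pos.mpr hi
  field_simp
  rw [sq, this]

/-! ### Gaussian concentration of the sample covariance. -/

theorem integral_exp_mul_sq_gaussianReal {w : ℝ} (hw : w < 1 / 2) :
    ∫ x, Real.exp (w * x ^ 2) ∂(gaussianReal 0 1) = (√(1 - 2 * w))⁻¹ := by
  rw [integral_gaussianReal_eq_integral_smul one_ne_zero]
  have h : ∀ x : ℝ, gaussianPDFReal 0 1 x • Real.exp (w * x ^ 2) =
      (√(2 * Real.pi))⁻¹ * Real.exp (-(1 / 2 - w) * x ^ 2) := fun x => by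
    rw [gaussianPDFReal_def, smul_eq_mul, mul_assoc, ← Real.exp_add]
    simp only [NNReal.coe_one, mul_one, sub_zero]
    congr 2
    ring
  simp_rw [h]
  rw [integral_const_mul, integral_gaussian, ← Real.sqrt_inv, ← Real.sqrt_inv, ← Real.sqrt_mul]
  · congr 1
    have : (1 : ℝ) / 2 - w ≠ 0 := by linarith
    have h2 : (1 : ℝ) - 2 * w ≠ 0 := by linarith
    have h3 := Real.pi_ne_zero
    field_simp
  · positivity

theorem inv_sqrt_mul_exp_le {u : ℝ} (hu : |u| ≤ 1 / 2) :
    (√(1 - u))⁻¹ * Real.exp (-(u / 2)) ≤ Real.exp (u ^ 2) := by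
  have hu' := abs_le.mp hu
  have h1 : 0 < 1 - u := by linarith
  have hlog := (abs_le.mp (Real.abs_log_sub_add_sum_range_le (hu.trans_lt (by norm_num)) 1)).1
  simp only [Finset.range_one, Finset.sum_singleton, zero_add, pow_one, Nat.cast_zero, div_one,
    Nat.reduceAdd, sq_abs] at hlog
  have hle : u ^ 2 / (1 - |u|) ≤ 2 * u ^ 2 := by
    rw [div_le_iff₀ (by linarith)]
    nlinarith [sq_nonneg u]
  have hs : (√(1 - u))⁻¹ = Real.exp (-(Real.log (1 - u) / 2)) := by
    rw [Real.exp_neg, ← Real.log_sqrt h1.le, Real.exp_log (Real.sqrt_pos.mpr h1)]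
  rw [hs, ← Real.exp_add, Real.exp_le_exp]
  linarith

/-- Rescaling to a standard normal reduces this to `inv_sqrt_mul_exp_le` with `u = 2sv`: the ranges
of `s` and `v` give `|u| ≤ 1/2` and `u² ≤ 64s²`. -/
theorem mgf_sq_sub_gaussian {Ω : Type*} [MeasurableSpace Ω] {P : Measure Ω} {Y : Ω → ℝ}
    {v : ℝ} (hv0 : 0 ≤ v) (hv : v ≤ 4) (hY : HasLaw Y (gaussianReal 0 v.toNNReal) P) {s : ℝ}
    (hs : |s| ≤ 1 / 16) :
    0 < mgf (fun ω => Y ω ^ 2 - v) P s ∧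
      mgf (fun ω => Y ω ^ 2 - v) P s ≤ Real.exp (64 * s ^ 2) := by
  have hu : |2 * (s * v)| ≤ 1 / 2 := by
    rw [abs_mul, abs_mul, abs_two, abs_of_nonneg hv0]
    nlinarith [abs_nonneg s]
  have hu1 := abs_le.mp hu
  have hmgf : mgf (fun ω => Y ω ^ 2 - v) P s =
      (√(1 - 2 * (s * v)))⁻¹ * Real.exp (-(2 * (s * v) / 2)) := by
    have h1 : mgf (fun ω => Y ω ^ 2 - v) P s =
        ∫ y, Real.exp (s * (y ^ 2 - v)) ∂(gaussianReal 0 v.toNNReal) :=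
      hY.integral_comp (f := fun y => Real.exp (s * (y ^ 2 - v))) (by fun_prop)
    have h2 : gaussianReal 0 v.toNNReal = (gaussianReal 0 1).map (√v * ·) := by
      rw [gaussianReal_map_const_mul, mul_zero, mul_one]
      congr 1
      ext
      simp [Real.sq_sqrt hv0, hv0]
    rw [h1, h2, integral_map (by fun_prop) (by fun_prop), ← integral_exp_mul_sq_gaussianReal
      (by linarith), ← integral_mul_const]
    refine integral_congr_ae (ae_of_all _ fun x => ?_)
    simp only
    rw [← Real.exp_add, mul_pow, Real.sq_sqrt hv0]
    congr 1
    ring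
  rw [hmgf]
  have hpos : 0 < 1 - 2 * (s * v) := by linarith
  refine ⟨by positivity, (inv_sqrt_mul_exp_le hu).trans (Real.exp_le_exp.mpr ?_)⟩
  have : v ^ 2 ≤ 16 := by nlinarith
  nlinarith [sq_nonneg s]

theorem measureReal_le_of_mgf_le {Ω : Type*} [MeasurableSpace Ω] {P : Measure Ω}
    [IsProbabilityMeasure P] {n : ℕ} {Z : Fin n → Ω → ℝ} (hZ : iIndepFun Z P)
    (hm : ∀ r, AEMeasurable (Z r) P)
    {s : ℝ} (hs : 0 ≤ s) (hmgf : ∀ r, 0 < mgf (Z r) P s ∧ mgf (Z r) P s ≤ Real.exp (64 * s ^ 2))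
    (c : ℝ) :
    P.real {ω | n * c ≤ ∑ r, Z r ω} ≤ Real.exp (n * (64 * s ^ 2 - s * c)) := by
  have hsum := hZ.mgf_sum₀ (t := s) hm Finset.univ
  have hpos : 0 < mgf (∑ r, Z r) P s := by
    rw [hsum]; exact Finset.prod_pos fun r _ => (hmgf r).1
  -- A non-integrable exponential would make `mgf` take its default value zero, so positivity yields
  -- integrability.
  have hint : Integrable (fun ω => Real.exp (s * (∑ r, Z r) ω)) P := by
    by_contra h
    exact hpos.ne' (mgf_undef h)
  have h := measure_ge_le_exp_mul_mgf (n * c) hs hint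
  simp only [Finset.sum_apply] at h
  refine h.trans ?_
  have hprod : mgf (∑ r, Z r) P s ≤ Real.exp (64 * s ^ 2) ^ n := by
    rw [hsum]
    refine (Finset.prod_le_prod (fun r _ => (hmgf r).1.le) fun r _ => (hmgf r).2).trans ?_
    simp
  calc _ ≤ Real.exp (-s * (n * c)) * Real.exp (64 * s ^ 2) ^ n := by gcongr
    _ = _ := by
      rw [← Real.exp_nat_mul, ← Real.exp_add]
      congr 1
      ring

theorem measureReal_sq_deviation_le {Ω : Type*} [MeasurableSpace Ω] {P : Measure Ω}
    [IsProbabilityMeasure P] {n : ℕ} {Y : Fin n → Ω → ℝ} (hYi : iIndepFun Y P) {v : ℝ}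
    (hv0 : 0 ≤ v) (hv : v ≤ 4) (hY : ∀ r, HasLaw (Y r) (gaussianReal 0 v.toNNReal) P)
    {t : ℝ} (ht0 : 0 ≤ t) (ht : t ≤ 8) :
    P.real {ω | n * t ≤ |∑ r, (Y r ω ^ 2 - v)|} ≤ 2 * Real.exp (-(n * t ^ 2 / 256)) := by
  -- The choice `s = t/128` minimises `64s² - st`, with value `-t²/256`; `t ≤ 8` keeps it in the
  -- admissible range.
  have hs : |t / 128| ≤ 1 / 16 := by rw [abs_of_nonneg (by positivity)]; linarith
  have hs' : |-(t / 128)| ≤ 1 / 16 := by rwa [abs_neg]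
  have h1 := measureReal_le_of_mgf_le (Z := fun r ω => Y r ω ^ 2 - v)
    (hYi.comp (fun _ y => y ^ 2 - v) fun _ => by fun_prop)
    (fun r => ((hY r).aemeasurable.pow_const 2).sub_const v) (s := t / 128) (by positivity)
    (fun r => mgf_sq_sub_gaussian hv0 hv (hY r) hs) t
  have h2 := measureReal_le_of_mgf_le (Z := fun r ω => -(Y r ω ^ 2 - v))
    (hYi.comp (fun _ y => -(y ^ 2 - v)) fun _ => by fun_prop)
    (fun r => (((hY r).aemeasurable.pow_const 2).sub_const v).neg) (s := t / 128) (by positivity)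
    (fun r => by
      have := mgf_sq_sub_gaussian hv0 hv (hY r) hs'
      rw [← mgf_neg] at this
      simpa [Pi.neg_def] using this) t
  have he : (n : ℝ) * (64 * (t / 128) ^ 2 - t / 128 * t) = -(n * t ^ 2 / 256) := by ring
  rw [he] at h1 h2
  calc P.real {ω | n * t ≤ |∑ r, (Y r ω ^ 2 - v)|}
      ≤ P.real ({ω | n * t ≤ ∑ r, (Y r ω ^ 2 - v)} ∪ {ω | n * t ≤ ∑ r, -(Y r ω ^ 2 - v)}) := by
        refine measureReal_mono fun ω hω => ?_
        rcases le_abs.mp (show (n : ℝ) * t ≤ |∑ r, (Y r ω ^ 2 - v)| from hω) with h | h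
        · exact Or.inl h
        · exact Or.inr (by simpa only [Set.mem_ofPred_eq, Finset.sum_neg_distrib] using h)
    _ ≤ _ := (measureReal_union_le _ _).trans (by linarith)

theorem hasLaw_add_mul_multivariateGaussian {p : ℕ} {T : Matrix (Fin p) (Fin p) ℝ}
    (hT : T.PosSemidef) (i j : Fin p) (e : ℝ) :
    HasLaw (fun x : EuclideanSpace ℝ (Fin p) => x i + e * x j)
      (gaussianReal 0 (T i i + 2 * e * T i j + e ^ 2 * T j j).toNNReal)
      (multivariateGaussian 0 T) := by
  refine ⟨by fun_prop, ?_⟩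
  set L : StrongDual ℝ (EuclideanSpace ℝ (Fin p)) :=
    EuclideanSpace.proj i + e • EuclideanSpace.proj j
  have hL : (fun x : EuclideanSpace ℝ (Fin p) => x i + e * x j) = L := by ext x; simp [L]
  have hmem : ∀ k, MemLp (fun x : EuclideanSpace ℝ (Fin p) => x k) 2 (multivariateGaussian 0 T) :=
    fun k => IsGaussian.memLp_dual _ (EuclideanSpace.proj k) 2 (by simp)
  have hmean : ∫ x, L x ∂(multivariateGaussian 0 T) = 0 := by
    rw [L.integral_comp_id_comm IsGaussian.integrable_id, integral_id_multivariateGaussian,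
      map_zero]
  have hvar : Var[L; multivariateGaussian 0 T] = T i i + 2 * e * T i j + e ^ 2 * T j j := by
    rw [← hL, variance_fun_add (hmem i) ((hmem j).const_mul e), variance_const_mul,
      covariance_const_mul_right, covariance_eval_multivariateGaussian hT,
      variance_eval_multivariateGaussian hT, variance_eval_multivariateGaussian hT]
    ring
  rw [hL, IsGaussian.map_eq_gaussianReal, hmean, hvar]

theorem add_mul_quadratic_nonneg {p : ℕ} {T : Matrix (Fin p) (Fin p) ℝ}
    (hT : T.PosSemidef) (i j : Fin p) (e : ℝ) : 0 ≤ T i i + 2 * e * T i j + e ^ 2 * T j j := by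
  have h := hT.dotProduct_mulVec_nonneg (Pi.single i 1 + e • Pi.single j 1)
  have hs : T j i = T i j := by simpa using hT.1.apply i j
  simp [Matrix.mulVec_add, Matrix.mulVec_smul, dotProduct_add, add_dotProduct, hs] at h
  linarith

theorem sampleCovariance_apply {n p : ℕ} (x : Fin n → EuclideanSpace ℝ (Fin p)) (i j : Fin p) :
    sampleCovariance x i j = (n : ℝ)⁻¹ * ∑ r, x r i * x r j := by
  simp [sampleCovariance, Matrix.sum_apply, Matrix.vecMulVec_apply]

section Sample

variable {Ω : Type*} [MeasurableSpace Ω] {P : Measure Ω} {n p : ℕ}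
  {T : Matrix (Fin p) (Fin p) ℝ} {X : Fin n → Ω → EuclideanSpace ℝ (Fin p)}

theorem ae_sampleCovariance_self_pos (hn : 0 < n) (hT : T.PosSemidef)
    (hdiag : ∀ i, T i i = 1) (hlaw : ∀ r, HasLaw (X r) (multivariateGaussian 0 T) P) :
    ∀ᵐ ω ∂P, ∀ i, 0 < sampleCovariance (fun r => X r ω) i i := by
  rw [ae_all_iff]
  intro i
  have hl := (measurePreserving_eval_multivariateGaussian (μ := 0) hT (i := i)).fun_comp_hasLaw
    (hlaw ⟨0, hn⟩)
  rw [hdiag, Real.toNNReal_one] at hl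
  have : NullSingletonClass (gaussianReal ((0 : EuclideanSpace ℝ (Fin p)) i) 1) :=
    nullSingletonClass_gaussianReal one_ne_zero
  have hne : ∀ᵐ y ∂(gaussianReal ((0 : EuclideanSpace ℝ (Fin p)) i) 1), y ≠ 0 := by
    rw [ae_iff]
    simp only [ne_eq, not_not, Set.ofPred_eq_eq_singleton]
    exact measure_singleton 0
  filter_upwards [(hl.ae_iff (p := fun y => y ≠ 0) (by measurability)).mpr hne] with ω hω
  rw [sampleCovariance_apply]
  refine mul_pos (by positivity) (Finset.sum_pos' (fun r _ => mul_self_nonneg _)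
    ⟨⟨0, hn⟩, Finset.mem_univ _, mul_self_pos.mpr hω⟩)

variable [IsProbabilityMeasure P]

/-- Polarisation `4xy = (x + y)² - (x - y)²` reduces products to squares of centred Gaussians.
Nonnegativity of one variance bounds the other by `4`. -/
theorem measureReal_sampleCovariance_deviation_le (hn : 0 < n) (hT : T.PosSemidef)
    (hdiag : ∀ i, T i i = 1) (hlaw : ∀ r, HasLaw (X r) (multivariateGaussian 0 T) P)
    (hX : iIndepFun X P) {t : ℝ} (ht0 : 0 ≤ t) (ht : t ≤ 1) (i j : Fin p) :
    P.real {ω | t < |sampleCovariance (fun r => X r ω) i j - T i j|} ≤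
      4 * Real.exp (-(n * t ^ 2 / 64)) := by
  have hn' : (0 : ℝ) < n := by exact_mod_cast hn
  have h1 := add_mul_quadratic_nonneg hT i j 1
  have h2 := add_mul_quadratic_nonneg hT i j (-1)
  have dev : ∀ e : ℝ, e ^ 2 = 1 → P.real {ω | n * (2 * t) ≤ |∑ r, ((X r ω i + e * X r ω j) ^ 2 -
      (T i i + 2 * e * T i j + e ^ 2 * T j j))|} ≤ 2 * Real.exp (-(n * t ^ 2 / 64)) := by
    intro e he
    have hle : T i i + 2 * e * T i j + e ^ 2 * T j j ≤ 4 := by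
      rcases mul_self_eq_one_iff.mp ((sq e).symm.trans he) with rfl | rfl <;> simp only [hdiag] at * <;> linarith
    have := measureReal_sq_deviation_le (P := P) (Y := fun r ω => X r ω i + e * X r ω j)
      (hX.comp (fun _ x => x i + e * x j) fun _ => by fun_prop)
      (add_mul_quadratic_nonneg hT i j e) hle
      (fun r => (hasLaw_add_mul_multivariateGaussian hT i j e).comp (hlaw r))
      (t := 2 * t) (by linarith) (by linarith)
    refine this.trans_eq ?_
    congr 3
    ring
  have d1 := dev 1 (by norm_num)
  have d2 := dev (-1) (by norm_num)
  refine (measureReal_mono (fun ω hω => ?_) (measure_ne_top _ _)).trans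
    ((measureReal_union_le _ _).trans ((add_le_add d1 d2).trans_eq (by ring)))
  by_contra hcon
  rw [Set.mem_union, not_or, Set.mem_ofPred_eq, Set.mem_ofPred_eq] at hcon
  have c1 := abs_lt.mp (not_le.mp hcon.1)
  have c2 := abs_lt.mp (not_le.mp hcon.2)
  refine absurd (show t < |sampleCovariance (fun r => X r ω) i j - T i j| from hω) (not_lt.mpr ?_)
  have key : sampleCovariance (fun r => X r ω) i j - T i j =
      (∑ r, ((X r ω i + 1 * X r ω j) ^ 2 - (T i i + 2 * 1 * T i j + 1 ^ 2 * T j j)) -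
        ∑ r, ((X r ω i + -1 * X r ω j) ^ 2 -
          (T i i + 2 * (-1) * T i j + (-1) ^ 2 * T j j))) / (4 * n) := by
    rw [sampleCovariance_apply, ← Finset.sum_sub_distrib, eq_div_iff (by positivity)]
    have : ∀ r, (X r ω i + 1 * X r ω j) ^ 2 - (T i i + 2 * 1 * T i j + 1 ^ 2 * T j j) -
        ((X r ω i + -1 * X r ω j) ^ 2 - (T i i + 2 * (-1) * T i j + (-1) ^ 2 * T j j)) =
        4 * (X r ω i * X r ω j) - 4 * T i j := fun r => by ring
    simp_rw [this]
    rw [Finset.sum_sub_distrib, ← Finset.mul_sum, Finset.sum_const, Finset.card_univ,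
      Fintype.card_fin, nsmul_eq_mul]
    field_simp
  rw [key, abs_div, abs_of_pos (show (0 : ℝ) < 4 * n by positivity), div_le_iff₀ (by positivity)]
  exact abs_le.mpr ⟨by linarith, by linarith⟩

theorem measureReal_exists_sampleCovariance_deviation_le (hn : 0 < n) (hT : T.PosSemidef)
    (hdiag : ∀ i, T i i = 1) (hlaw : ∀ r, HasLaw (X r) (multivariateGaussian 0 T) P)
    (hX : iIndepFun X P) {t : ℝ} (ht0 : 0 ≤ t) (ht : t ≤ 1) :
    P.real {ω | ∃ i j, t < |sampleCovariance (fun r => X r ω) i j - T i j|} ≤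
      p ^ 2 * (4 * Real.exp (-(n * t ^ 2 / 64))) := by
  simp only [Set.ofPred_exists]
  refine (measureReal_iUnion_fintype_le _).trans ?_
  refine (Finset.sum_le_sum fun i _ => (measureReal_iUnion_fintype_le _).trans
    (Finset.sum_le_sum fun j _ =>
      measureReal_sampleCovariance_deviation_le hn hT hdiag hlaw hX ht0 ht i j)).trans_eq ?_
  simp only [Finset.sum_const, Finset.card_univ, Fintype.card_fin, nsmul_eq_mul]
  ring

end Sample

theorem Matrix.abs_entry_le_norm {m : Type*} [Fintype m] (W : Matrix m m ℝ) (i j : m) :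
    |W i j| ≤ ‖W‖ := by
  refine abs_le_of_sq_le_sq ?_ (norm_nonneg _)
  rw [Matrix.frobenius_norm_sq_eq_sum]
  exact (Finset.single_le_sum (f := fun j => W i j ^ 2) (fun _ _ => sq_nonneg _)
    (Finset.mem_univ j)).trans (Finset.single_le_sum (f := fun i => ∑ j, W i j ^ 2)
      (fun _ _ => Finset.sum_nonneg fun _ _ => sq_nonneg _) (Finset.mem_univ i))

/-- Trace bound for the sampling error of the correlation matrix along a pattern `E`. The case
of no edges needs no closeness at all, since the diagonal of a correlation matrix is exact. -/
theorem abs_trace_mul_sampleCorrelation_sub_le {n p : ℕ} {x : Fin n → EuclideanSpace ℝ (Fin p)}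
    {T : Matrix (Fin p) (Fin p) ℝ} (hdiag : ∀ i, T i i = 1) (hT : ∀ i j, |T i j| ≤ 1)
    (hx : ∀ i, 0 < sampleCovariance x i i) {E : SimpleGraph (Fin p)} {t : ℝ} (ht0 : 0 ≤ t)
    (ht : edgeSize E = 0 ∨
      (t ≤ 1 / 2 ∧ ∀ i j, |sampleCovariance x i j - T i j| ≤ t))
    {D : Matrix (Fin p) (Fin p) ℝ} (hD : ∀ i j, i ≠ j → ¬ E.Adj i j → D i j = 0) :
    |(D * (sampleCorrelation x - T)).trace| ≤ 4 * t * √(edgeSize E) * ‖D‖ := by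
  have hW0 : ∀ i, (sampleCorrelation x - T) i i = 0 := fun i => by
    rw [Matrix.sub_apply, sampleCorrelation_self x (hx i), hdiag, sub_self]
  rcases ht with h0 | ⟨ht, hdev⟩
  · have := abs_trace_mul_le_of_support E hD hW0 (norm_nonneg (sampleCorrelation x - T))
      fun i j _ => Matrix.abs_entry_le_norm _ j i
    simpa [h0] using this
  · refine abs_trace_mul_le_of_support E hD hW0 (by positivity) fun i j _ => ?_
    have := abs_sampleCorrelation_sub_le x hdiag hT ht hdev j i
    rw [Matrix.sub_apply]
    linarith

/-! ### The rate and the tail at the chosen threshold. -/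

section Rate

variable {p S : ℕ → ℕ}

theorem GrowthAssumption.tendsto_rate (h : GrowthAssumption p S) :
    Tendsto (fun n => √(S n * Real.log ((max n (p n) : ℕ) : ℝ) / n)) atTop (𝓝 0) := by
  have hz : ∀ᶠ n : ℕ in atTop,
      (n : ℝ) / Real.log ((max n (p n) : ℕ) : ℝ) = 0 → (S n : ℝ) = 0 := by
    filter_upwards [eventually_ge_atTop 2] with n hn h0
    have h1 : (1 : ℝ) < ((max n (p n) : ℕ) : ℝ) := by
      exact_mod_cast lt_of_lt_of_le hn (le_max_left _ _)
    have : 0 < (n : ℝ) / Real.log ((max n (p n) : ℕ) : ℝ) :=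
      div_pos (by positivity) (Real.log_pos h1)
    exact absurd h0 this.ne'
  have h1 := (isLittleO_iff_tendsto' hz).mp h.sparsity_isLittleO
  have h2 := h1.sqrt
  rw [Real.sqrt_zero] at h2
  exact h2.congr fun n => by rw [div_div_eq_mul_div]

/-- The constant `14` is chosen so that `14²/64 ≥ 3`: the tail is at most `max(n,p)⁻³`, beating the
`p²` of the union bound. -/
theorem sq_mul_exp_neg_log_le {n p : ℕ} (hn : 0 < n) :
    (p : ℝ) ^ 2 * (4 * Real.exp
      (-(n * (14 * √(Real.log ((max n p : ℕ) : ℝ) / n)) ^ 2 / 64))) ≤ 4 / n := by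
  have hn' : (0 : ℝ) < n := by exact_mod_cast hn
  set M : ℝ := ((max n p : ℕ) : ℝ)
  have hnM : (n : ℝ) ≤ M := Nat.cast_le.mpr (le_max_left n p)
  have hpM : (p : ℝ) ≤ M := Nat.cast_le.mpr (le_max_right n p)
  have hM : 1 ≤ M := le_trans (by exact_mod_cast hn) hnM
  have hL : 0 ≤ Real.log M := Real.log_nonneg hM
  have hexp : Real.exp (-(n * (14 * √(Real.log M / n)) ^ 2 / 64)) ≤ (M ^ 3)⁻¹ := by
    have : (M ^ 3)⁻¹ = Real.exp (-(3 * Real.log M)) := by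
      rw [Real.exp_neg, ← Real.log_rpow (by linarith), Real.exp_log (by positivity)]
      norm_cast
    rw [this, Real.exp_le_exp, mul_pow, Real.sq_sqrt (by positivity)]
    field_simp
    nlinarith
  calc (p : ℝ) ^ 2 * (4 * Real.exp (-(n * (14 * √(Real.log M / n)) ^ 2 / 64)))
      ≤ M ^ 2 * (4 * (M ^ 3)⁻¹) := by gcongr
    _ = 4 / M := by field_simp
    _ ≤ 4 / n := by gcongr

end Rate

/-! ### Assembly on the good event. -/

/-- With probability tending to one the minimizer exists, is unique and is close to the truth. -/
theorem exists_events_refittedMLE_close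
    (p : ℕ → ℕ)
    (S₀ : ∀ n, Matrix (Fin (p n)) (Fin (p n)) ℝ)
    (hcov : ∀ n, (S₀ n).PosSemidef)
    (hunit : ∀ n i, S₀ n i i = 1)
    (S : ℕ → ℕ) (hS : ∀ n, S n = edgeSize (concentrationGraph (S₀ n)⁻¹))
    (hA1 : GrowthAssumption p S)
    (hA2 : SpectralAssumption S₀)
    {Ω : ℕ → Type*} [∀ n, MeasurableSpace (Ω n)]
    (P : ∀ n, Measure (Ω n)) [∀ n, IsProbabilityMeasure (P n)]
    (X : ∀ n, Fin n → Ω n → EuclideanSpace ℝ (Fin (p n)))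
    (hlaw : ∀ n r, HasLaw (X n r) (multivariateGaussian 0 (S₀ n)) (P n))
    (hindep : ∀ n, iIndepFun (X n) (P n))
    (E : ∀ n, Ω n → SimpleGraph (Fin (p n)))
    (𝓔 : ∀ n, Set (Ω n)) (h𝓔 : ∀ n, MeasurableSet (𝓔 n))
    (d : ℝ) (hprob : ∀ n, 1 - d / (p n : ℝ) ^ 2 ≤ (P n).real (𝓔 n))
    (hscreen : ∀ n, ∀ ω ∈ 𝓔 n, concentrationGraph (S₀ n)⁻¹ ≤ E n ω)
    (hfalse : ∃ C : ℝ, ∀ᶠ n in atTop, ∀ ω ∈ 𝓔 n,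
      (edgeSize (E n ω \ concentrationGraph (S₀ n)⁻¹) : ℝ) ≤ C * S n) :
    ∃ K : ℝ, 0 < K ∧ ∀ᶠ n in atTop, ∃ G : Set (Ω n),
      (P n).real Gᶜ ≤ d / (p n : ℝ) ^ 2 + 4 / n ∧ ∀ ω ∈ G,
        (∃! Θ, IsRefittedMLE (fun r => X n r ω) (E n ω) Θ) ∧
        ‖refittedMLE (fun r => X n r ω) (E n ω) - (S₀ n)⁻¹‖ ≤
          K * √(S n * Real.log ((max n (p n) : ℕ) : ℝ) / n) := by
  obtain ⟨a, b, ha, hab, hspec⟩ := hA2.eigenvalues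
  obtain ⟨C, hC⟩ := hfalse
  have hb : 0 < b := ha.trans_le hab
  set C' := max C 0
  have hC' : 0 ≤ C' := le_max_right _ _
  set R : ℕ → ℝ := fun n => √(S n * Real.log ((max n (p n) : ℕ) : ℝ) / n) with hR
  have hR0 : Tendsto R atTop (𝓝 0) := hA1.tendsto_rate
  -- `56 = 4 · 14`, from the bound `4t√|E|` with `|E| ≤ (1 + C')S`.
  set c := 56 * √(1 + C') with hc
  have hc0 : 0 < c := by positivity
  have hlim : ∀ k δ : ℝ, 0 < δ → ∀ᶠ n in atTop, k * R n < δ := fun k δ hδ => by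
    have := hR0.const_mul k
    rw [mul_zero] at this
    exact this.eventually_lt_const hδ
  refine ⟨8 * c / a ^ 2, by positivity, ?_⟩
  filter_upwards [hC, eventually_gt_atTop 0, hlim c (a / 4) (by positivity),
    hlim (8 * c / a ^ 2) b⁻¹ (by positivity), hlim 14 (1 / 2) (by norm_num)]
    with n hCn hn hl1 hl2 hl3
  have hn' : (0 : ℝ) < n := by exact_mod_cast hn
  set L := Real.log ((max n (p n) : ℕ) : ℝ)
  have hL : 0 ≤ L := Real.log_natCast_nonneg _
  set t := 14 * √(L / n) with ht
  have ht0 : 0 ≤ t := by positivity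
  have hRn : R n = √(S n) * √(L / n) := by
    rw [← Real.sqrt_mul (Nat.cast_nonneg _), ← mul_div_assoc]
  have hTa : (S₀ n - a • 1).PosSemidef :=
    Matrix.PosSemidef.sub_smul_one_of_spectrum (hcov n).1 fun x hx => (hspec n x hx).1
  have hTb : (b • 1 - S₀ n).PosSemidef :=
    Matrix.PosSemidef.smul_one_sub_of_spectrum (hcov n).1 fun x hx => (hspec n x hx).2
  have hT : (S₀ n).PosDef := by
    have := Matrix.PosDef.posSemidef_add hTa
      ((Matrix.PosDef.one (n := Fin (p n)) (R := ℝ)).smul ha)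
    rwa [sub_add_cancel] at this
  have hent : ∀ i j, |S₀ n i j| ≤ 1 := fun i j => by
    have h1 := add_mul_quadratic_nonneg (hcov n) i j 1
    have h2 := add_mul_quadratic_nonneg (hcov n) i j (-1)
    simp only [hunit] at h1 h2
    exact abs_le.mpr ⟨by linarith, by linarith⟩
  set V : Set (Ω n) := {ω | ¬ ∀ i, 0 < sampleCovariance (fun r => X n r ω) i i}
  have hV : (P n).real V = 0 := by
    rw [measureReal_eq_zero_iff]
    exact ae_iff.mp (ae_sampleCovariance_self_pos hn (hcov n) (hunit n) (hlaw n))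
  -- Smallness of `t` comes from `√(L/n) ≤ R n`, which needs `S n ≥ 1`. For `S n = 0` the selected
  -- graph is empty on `𝓔 n` and no deviation bound is needed.
  set B : Set (Ω n) := {ω | S n ≠ 0 ∧
    ∃ i j, t < |sampleCovariance (fun r => X n r ω) i j - S₀ n i j|}
  have ht1 : S n ≠ 0 → t ≤ 1 / 2 := fun hSn => by
    have h1 : 1 ≤ √(S n : ℝ) := by
      rw [Real.one_le_sqrt]
      exact_mod_cast Nat.one_le_iff_ne_zero.mpr hSn
    have h2 : √(L / n) ≤ R n := by
      rw [hRn]; exact le_mul_of_one_le_left (Real.sqrt_nonneg _) h1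
    linarith
  have hB : (P n).real B ≤ 4 / n := by
    by_cases hSn : S n = 0
    · have : B = ∅ := Set.eq_empty_of_forall_notMem fun ω hω => hω.1 hSn
      rw [this, measureReal_empty]
      positivity
    · refine (measureReal_mono (fun ω hω => hω.2) (measure_ne_top _ _)).trans
        ((measureReal_exists_sampleCovariance_deviation_le hn (hcov n) (hunit n) (hlaw n)
          (hindep n) ht0 ((ht1 hSn).trans (by norm_num))).trans (sq_mul_exp_neg_log_le hn))
  refine ⟨((𝓔 n)ᶜ ∪ (V ∪ B))ᶜ, ?_, fun ω hω => ?_⟩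
  · rw [compl_compl]
    have h1 : (P n).real (𝓔 n)ᶜ ≤ d / (p n : ℝ) ^ 2 := by
      rw [probReal_compl_eq_one_sub (h𝓔 n)]
      linarith [hprob n]
    have h2 := measureReal_union_le (μ := P n) (𝓔 n)ᶜ (V ∪ B)
    have h3 := measureReal_union_le (μ := P n) V B
    linarith
  · simp only [Set.mem_compl_iff, Set.mem_union, not_or, not_not] at hω
    obtain ⟨hω𝓔, hωV, hωB⟩ := hω
    have hpos : ∀ i, 0 < sampleCovariance (fun r => X n r ω) i i := not_not.mp hωV
    have hsize : (edgeSize (E n ω) : ℝ) ≤ (1 + C') * S n := by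
      have h1 : (edgeSize (E n ω) : ℝ) ≤ edgeSize (concentrationGraph (S₀ n)⁻¹) +
          edgeSize (E n ω \ concentrationGraph (S₀ n)⁻¹) := by
        exact_mod_cast edgeSize_le_add_sdiff _ _
      have h2 : C * S n ≤ C' * S n :=
        mul_le_mul_of_nonneg_right (le_max_left _ _) (Nat.cast_nonneg _)
      rw [← hS] at h1
      linarith [hCn ω hω𝓔]
    have hcase : edgeSize (E n ω) = 0 ∨ (t ≤ 1 / 2 ∧
        ∀ i j, |sampleCovariance (fun r => X n r ω) i j - S₀ n i j| ≤ t) := by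
      by_cases hSn : S n = 0
      · left
        rw [hSn, Nat.cast_zero, mul_zero] at hsize
        exact_mod_cast le_antisymm hsize (Nat.cast_nonneg _)
      · refine Or.inr ⟨ht1 hSn, fun i j => ?_⟩
        by_contra hcon
        exact hωB ⟨hSn, i, j, not_le.mp hcon⟩
    have hlin : 4 * t * √(edgeSize (E n ω)) ≤ c * R n := by
      calc 4 * t * √(edgeSize (E n ω)) ≤ 4 * t * √((1 + C') * S n) := by gcongr
        _ = c * R n := by
          rw [Real.sqrt_mul (by positivity), hRn]
          ring
    have := refittedMLE_of_linear_bound (fun r => X n r ω) hT (hscreen n ω hω𝓔) ha hTa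
      (hT.inv_sub_smul_one hb hTb) (l := c * R n) (mul_nonneg hc0.le (Real.sqrt_nonneg _)) hl1.le
      (by convert hl2 using 1; ring)
      (fun D hD => (abs_trace_mul_sampleCorrelation_sub_le (hunit n) hent hpos ht0 hcase
        hD).trans (by gcongr))
    refine ⟨this.1, this.2.trans_eq ?_⟩
    change _ = _ * R n
    ring

theorem mainTheorem7
    (p : ℕ → ℕ) (hp : ∀ n, 0 < p n)
    (S₀ : ∀ n, Matrix (Fin (p n)) (Fin (p n)) ℝ)
    (hcov : ∀ n, (S₀ n).PosSemidef)
    (hunit : ∀ n i, S₀ n i i = 1)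
    (S : ℕ → ℕ) (hS : ∀ n, S n = edgeSize (concentrationGraph (S₀ n)⁻¹))
    (hA1 : GrowthAssumption p S)
    (hA2 : SpectralAssumption S₀)
    {Ω : ℕ → Type*} [∀ n, MeasurableSpace (Ω n)]
    (P : ∀ n, Measure (Ω n)) [∀ n, IsProbabilityMeasure (P n)]
    (X : ∀ n, Fin n → Ω n → EuclideanSpace ℝ (Fin (p n)))
    (hlaw : ∀ n r, HasLaw (X n r) (multivariateGaussian 0 (S₀ n)) (P n))
    (hindep : ∀ n, iIndepFun (X n) (P n))
    (E : ∀ n, Ω n → SimpleGraph (Fin (p n)))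
    (𝓔 : ∀ n, Set (Ω n)) (h𝓔 : ∀ n, MeasurableSet (𝓔 n))
    (d : ℝ) (hprob : ∀ n, 1 - d / (p n : ℝ) ^ 2 ≤ (P n).real (𝓔 n))
    (hscreen : ∀ n, ∀ ω ∈ 𝓔 n, concentrationGraph (S₀ n)⁻¹ ≤ E n ω)
    (hfalse : ∃ C : ℝ, ∀ᶠ n in atTop, ∀ ω ∈ 𝓔 n,
      (edgeSize (E n ω \ concentrationGraph (S₀ n)⁻¹) : ℝ) ≤ C * S n) :
    Tendsto (fun n => P n {ω | ¬ ∃! Θ, IsRefittedMLE (fun r => X n r ω) (E n ω) Θ})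
      atTop (𝓝 0) ∧
    IsBigOP P (fun n ω => ‖refittedMLE (fun r => X n r ω) (E n ω) - (S₀ n)⁻¹‖)
      (fun n => Real.sqrt (S n * Real.log ((max n (p n) : ℕ) : ℝ) / n)) := by
  obtain ⟨K, hK, hG⟩ := exists_events_refittedMLE_close p S₀ hcov hunit S hS hA1 hA2 P X hlaw
    hindep E 𝓔 h𝓔 d hprob hscreen hfalse
  have hlim : Tendsto (fun n => d / (p n : ℝ) ^ 2 + 4 / n) atTop (𝓝 0) := by
    have hp' : Tendsto (fun n => (p n : ℝ) ^ 2) atTop atTop :=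
      (tendsto_pow_atTop two_ne_zero).comp (tendsto_natCast_atTop_atTop.comp hA1.dim_tendsto)
    simpa using (hp'.const_div_atTop d).add (tendsto_const_div_atTop_nhds_zero_nat (4 : ℝ))
  constructor
  · have hlim' := ENNReal.tendsto_ofReal hlim
    rw [ENNReal.ofReal_zero] at hlim'
    refine tendsto_of_tendsto_of_tendsto_of_le_of_le' tendsto_const_nhds hlim'
      (Eventually.of_forall fun _ => zero_le) ?_
    filter_upwards [hG] with n ⟨G, hGP, hG⟩
    -- This set need not be measurable, as `E` is arbitrary; monotonicity of the outer measure
    -- suffices.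
    calc P n {ω | ¬ ∃! Θ, IsRefittedMLE (fun r => X n r ω) (E n ω) Θ} ≤ P n Gᶜ :=
          measure_mono fun ω hω hωG => hω (hG ω hωG).1
      _ = ENNReal.ofReal ((P n).real Gᶜ) := (ofReal_measureReal (measure_ne_top _ _)).symm
      _ ≤ _ := ENNReal.ofReal_le_ofReal hGP
  · intro ε hε
    refine ⟨K, hK, ?_⟩
    filter_upwards [hG, hlim.eventually_lt_const hε] with n ⟨G, hGP, hG⟩ hεn
    calc P n _ ≤ P n Gᶜ := measure_mono fun ω hω hωG => by
          refine absurd (hG ω hωG).2 (not_le.mpr ?_)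
          rw [← abs_of_nonneg (norm_nonneg (refittedMLE (fun r => X n r ω) (E n ω) - (S₀ n)⁻¹))]
          exact hω
      _ = ENNReal.ofReal ((P n).real Gᶜ) := (ofReal_measureReal (measure_ne_top _ _)).symm
      _ ≤ _ := ENNReal.ofReal_le_ofReal (hGP.trans hεn.le)
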